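/- Let $d\in\{2,3\}$ and $\mathbb{T}=\mathbb{R}/2\pi\mathbb{Z}$. For $\xi=(\xi_1,\xi')\in\mathbb{R}\times\mathbb{R}^{d-1}$, $\xi'=\xi_2$ if $d=2$ and $\xi'=(\xi_2,\xi_3)$ if $d=3$, let $A_\xi$ be the operator on $L^2(\mathbb{T})$ with domain $H^2(\mathbb{T})$ given by $$A_\xi=-\partial_{x_1}^2-2i\xi_1\partial_{x_1}+|\xi|^2-q_\xi(x_1),\qquad q_\xi(x_1)=\begin{cases}\xi_2\cos x_1, & d=2,\\ \xi_2\cos x_1+\xi_3\sin x_1, & d=3,\end{cases}$$ let $\lambda_0(\xi)$ be its lowest eigenvalue, and put $|\xi_1|_*=\min_{n\in\mathbb{Z}}|\xi_1-n|$, $|\xi|_*=(|\xi_1|_*^2+|\xi'|^2)^{1/2}$. (Here $\xi_1$ is any representative of a class in $\mathbb{R}/\mathbb{Z}$; replacing $\xi_1$ by $\xi_1+n$, $n\in\mathbb{Z}$, conjugates $A_\xi$ with the multiplication by $e^{inx_1}$.) Let $n(\xi_1)$ be the integer nearest to $\xi_1$. Then there exist $\delta_0>0$ and $C_k>0$, $k\in\mathbb{Z}_{\ge0}$,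 such that for all $\xi$ with $|\xi|_*<\delta_0$ the eigenvalue $\lambda_0(\xi)$ exists and is simple, $$\lambda_0(\xi)=|\xi_1|_*^2+\tfrac12|\xi'|^2+o(|\xi|_*^2)\qquad(|\xi|_*\to0),$$ and, for a suitable choice of the phase, the $L^2(\mathbb{T})$-normalized eigenfunction $\phi_0(\xi,\cdot)$ for $\lambda_0(\xi)$ satisfies $$e^{i n(\xi_1)x_1}\phi_0(\xi,x_1)=\frac1{\sqrt{2\pi}}\bigl(1+q_\xi(x_1)\bigr)+R_0(\xi,x_1),$$ where $R_0(\xi,\cdot)$ is smooth and $2\pi$-periodic with $$|\partial_{x_1}^kR_0(\xi,x_1)|\le C_k|\xi|_*^2,\qquad x_1\in\mathbb{T},\ k\ge0.$$ In particular, if $\xi_1\in(-\frac12,\frac12)$, then $n(\xi_1)=0$ and the expansion holds for $\phi_0(\xi,x_1)$ itself. -/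

import Mathlib

open Real MeasureTheory Filter Topology Asymptotics
open scoped ContDiff

noncomputable section

/-- `|ξ₁|_*`, the distance of `ξ₁` to the nearest integer (`round ξ₁`), i.e. the distance of the
class of `ξ₁` to `0` in `ℝ/ℤ`. -/
def distInt (ξ₁ : ℝ) : ℝ := |ξ₁ - round ξ₁|

theorem distInt_isLeast (ξ₁ : ℝ) : IsLeast (Set.range fun n : ℤ => |ξ₁ - n|) (distInt ξ₁) :=
  ⟨⟨round ξ₁, rfl⟩, by rintro _ ⟨n, rfl⟩; exact round_le ξ₁ n⟩

/-- Wave numbers `ξ = (ξ₁, ξ')` with `ξ₁ ∈ ℝ` a representative of a class in `ℝ/ℤ` and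
`ξ' ∈ ℝ^{d-1}`; the coordinate `j` of `ξ'` (counted from `0`) is `ξ_{j+2}`. -/
abbrev WaveNumber (d : ℕ) : Type := ℝ × EuclideanSpace ℝ (Fin (d - 1))

/-- `|ξ|_* = (|ξ₁|_*² + |ξ'|²)^{1/2}`. -/
def starNorm {d : ℕ} (ξ : WaveNumber d) : ℝ := √(distInt ξ.1 ^ 2 + ‖ξ.2‖ ^ 2)

/-- `ξ₂ cos x` if `d = 2`, and `ξ₂ cos x + ξ₃ sin x` if `d = 3`. -/
def fibrePotential {d : ℕ} (ξ : WaveNumber d) (x : ℝ) : ℝ :=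
  ∑ j : Fin (d - 1), ξ.2 j * (if (j : ℕ) = 0 then cos x else sin x)

/-- Lebesgue measure on one period of the circle `𝕋 = ℝ/2πℤ`. Functions on `𝕋` are
`2π`-periodic functions on `ℝ`. -/
def periodMeasure : Measure ℝ := volume.restrict (Set.Ioc 0 (2 * π))

/-- `f ∈ L²(𝕋)`. -/
def MemL2Circle (f : ℝ → ℂ) : Prop :=
  Function.Periodic f (2 * π) ∧ MemLp f 2 periodMeasure

/-- `g` is the weak derivative of `f` on `𝕋`. -/
def IsWeakDerivCircle (f g : ℝ → ℂ) : Prop :=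
  ∀ ψ : ℝ → ℂ, ContDiff ℝ ∞ ψ → Function.Periodic ψ (2 * π) →
    ∫ x, f x * deriv ψ x ∂periodMeasure = - ∫ x, g x * ψ x ∂periodMeasure

/-- The graph of the operator `A_ξ` on `L²(𝕋)` with domain `H²(𝕋)`:
`f ∈ H²(𝕋)` (witnessed by its weak derivatives `f₁ = f'` and `f₂ = f''` in `L²(𝕋)`) and
`g = -f'' - 2 i ξ₁ f' + |ξ|² f - (ξ₂ cos x) f` for `d = 2`, with the further term
`- (ξ₃ sin x) f` for `d = 3`, as elements of `L²(𝕋)`. Here `|ξ|² = ξ₁² + |ξ'|²`. -/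
def IsFibreOp {d : ℕ} (ξ : WaveNumber d) (f g : ℝ → ℂ) : Prop :=
  MemL2Circle f ∧ ∃ f₁ f₂ : ℝ → ℂ, MemL2Circle f₁ ∧ MemL2Circle f₂ ∧
    IsWeakDerivCircle f f₁ ∧ IsWeakDerivCircle f₁ f₂ ∧
    g =ᵐ[periodMeasure] fun x =>
      - f₂ x - 2 * Complex.I * (ξ.1 : ℂ) * f₁ x + ((ξ.1 ^ 2 + ‖ξ.2‖ ^ 2 : ℝ) : ℂ) * f x
        - (fibrePotential ξ x : ℂ) * f x

/-- `f` is an eigenfunction of `A_ξ` (a nonzero element of its domain) with eigenvalue `μ`. -/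
def IsFibreEigenfunction {d : ℕ} (ξ : WaveNumber d) (μ : ℝ) (f : ℝ → ℂ) : Prop :=
  IsFibreOp ξ f (fun x => (μ : ℂ) * f x) ∧ ¬ f =ᵐ[periodMeasure] 0

/-- The set of eigenvalues of the (symmetric) operator `A_ξ`. -/
def fibreEigenvalues {d : ℕ} (ξ : WaveNumber d) : Set ℝ :=
  {μ | ∃ f, IsFibreEigenfunction ξ μ f}

/-- `λ₀(ξ)`, the lowest eigenvalue of `A_ξ`. -/
def lowestEigenvalue {d : ℕ} (ξ : WaveNumber d) : ℝ := sInf (fibreEigenvalues ξ)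

end

/-!
With `n = round ξ₁`, `s = ξ₁ - n`, `p = ‖ξ'‖`, the potential is `p cos (x - θ)` for some phase `θ`,
and writing `f = e^{-i n x} ∑ a_m e^{i m (x - θ)}` turns `A_ξ f = μ f` into the real three-term
recurrence `((m + s)² + p² - μ) a_m = (p / 2) (a_{m-1} + a_{m+1})`, where `|s|`, `p ≤ |ξ|_*`.

*Existence.* Normalize `c_0 = 1`. The equation at `m = 0` expresses `μ` through `c_{±1}`; the others
then read `c_m = (p / 2) (c_{m-1} + c_{m+1}) / D_m(c)` with `D_m` bounded below, a contraction of the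
unit ball of `ℓ^∞(ℤ, ℝ)` (`exists_recurrence_solution`). Each step away from `0` gains a factor `2p`
(`abs_le_pow_of_recurrence`), and one iteration gives `c_{±1} = p / 2 + O(p |ξ|_*)`, whence
`μ = s² + p² / 2 + O(|ξ|_*³)`. So the solution differs from the coefficients of `1 + p cos` by
`O(|ξ|_*²) 2^{-|m|}`, which bounds all derivatives of the remainder. The normalizing factor is
`1 + O(|ξ|_*²)` because `cos` has mean value zero.

*Minimality and simplicity.* The Fourier coefficients of any eigenfunction form a bounded solution of
the recurrence (`IsFibreEigenfunction.recurrence`). For spectral parameters up to `1 / 4` a bounded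
solution vanishes as soon as its central coefficient is at most half its supremum
(`eq_zero_of_recurrence`). Subtracting a multiple of `c` kills the central coefficient, which gives
simplicity. For a parameter below `μ`, orthogonality to `c` makes the central coefficient small.
-/

/-! ### The three-term recurrence in sequence space -/

/-- The off-diagonal denominators of the recurrence stay away from `0`. -/
theorem three_quarters_le_denominator {s p x y : ℝ} (hs : |s| ≤ 1 / 100) (hp0 : 0 ≤ p)
    (hp : p ≤ 1 / 100) (hx : |x| ≤ 1) (hy : |y| ≤ 1) {m : ℤ} (hm : m ≠ 0) :
    3 / 4 ≤ (m : ℝ) ^ 2 + 2 * m * s + p / 2 * (x + y) := by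
  have h1 : (1 : ℝ) ≤ |(m : ℝ)| := by exact_mod_cast Int.one_le_abs hm
  have h2 : -(|(m : ℝ)| * (1 / 100)) ≤ m * s := by
    have := mul_le_mul_of_nonneg_left hs (abs_nonneg (m : ℝ))
    rw [← abs_mul] at this
    linarith [neg_abs_le ((m : ℝ) * s)]
  have h3 : -(1 / 100 : ℝ) ≤ p / 2 * (x + y) := by
    have hx' := (abs_le.1 hx).1
    have hy' := (abs_le.1 hy).1
    nlinarith
  have h4 : (m : ℝ) ^ 2 = |(m : ℝ)| ^ 2 := (sq_abs _).symm
  nlinarith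

theorem half_le_denominator {s p x y : ℝ} (hs : |s| ≤ 1 / 100) (hp0 : 0 ≤ p) (hp : p ≤ 1 / 100)
    (hx : |x| ≤ 1) (hy : |y| ≤ 1) {m : ℤ} (hm : m ≠ 0) :
    1 / 2 ≤ (m : ℝ) ^ 2 + 2 * m * s + p / 2 * (x + y) :=
  le_trans (by norm_num) (three_quarters_le_denominator hs hp0 hp hx hy hm)

/-- One step of the iteration for the normalized solution (`c 0 = 1`) of the recurrence; its
denominator is `(m + s) ^ 2 + p ^ 2 - μ` with `μ` eliminated through the equation at `m = 0`. -/
noncomputable def recurrenceStep (s p : ℝ) (c : ℤ → ℝ) (m : ℤ) : ℝ :=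
  if m = 0 then 1 else
    p / 2 * (c (m - 1) + c (m + 1)) / ((m : ℝ) ^ 2 + 2 * m * s + p / 2 * (c 1 + c (-1)))

theorem abs_recurrenceStep_le {s p : ℝ} (hs : |s| ≤ 1 / 100) (hp0 : 0 ≤ p) (hp : p ≤ 1 / 100)
    {c : ℤ → ℝ} (hc : ∀ m, |c m| ≤ 1) (m : ℤ) : |recurrenceStep s p c m| ≤ 1 := by
  unfold recurrenceStep
  split_ifs with hm
  · simp
  have hD := half_le_denominator hs hp0 hp (hc 1) (hc (-1)) hm
  rw [abs_div, abs_of_pos (lt_of_lt_of_le (by norm_num) hD), div_le_one (by linarith)]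
  refine le_trans ?_ hD
  rw [abs_mul, abs_of_nonneg (by positivity)]
  have := (abs_add_le (c (m - 1)) (c (m + 1))).trans (add_le_add (hc _) (hc _))
  nlinarith

theorem abs_recurrenceStep_sub_le {s p : ℝ} (hs : |s| ≤ 1 / 100) (hp0 : 0 ≤ p) (hp : p ≤ 1 / 100)
    {c c' : ℤ → ℝ} (hc : ∀ m, |c m| ≤ 1) (hc' : ∀ m, |c' m| ≤ 1) {L : ℝ}
    (hL : ∀ m, |c m - c' m| ≤ L) (m : ℤ) :
    |recurrenceStep s p c m - recurrenceStep s p c' m| ≤ 1 / 2 * L := by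
  have hL0 : 0 ≤ L := (abs_nonneg _).trans (hL 0)
  unfold recurrenceStep
  split_ifs with hm
  · simpa using by positivity
  have hD := half_le_denominator hs hp0 hp (hc 1) (hc (-1)) hm
  have hD' := half_le_denominator hs hp0 hp (hc' 1) (hc' (-1)) hm
  set D := (m : ℝ) ^ 2 + 2 * m * s + p / 2 * (c 1 + c (-1)) with hDdef
  set D' := (m : ℝ) ^ 2 + 2 * m * s + p / 2 * (c' 1 + c' (-1)) with hDdef'
  have hDpos : 0 < D := by linarith
  have hDpos' : 0 < D' := by linarith
  have key : p / 2 * (c (m - 1) + c (m + 1)) / D - p / 2 * (c' (m - 1) + c' (m + 1)) / D'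
      = p / 2 * (((c (m - 1) - c' (m - 1)) + (c (m + 1) - c' (m + 1)))
          - (c' (m - 1) + c' (m + 1)) / D' * (D - D')) / D := by
    field_simp
    ring
  have hDD : |D - D'| ≤ p * L := by
    have : D - D' = p / 2 * ((c 1 - c' 1) + (c (-1) - c' (-1))) := by rw [hDdef, hDdef']; ring
    rw [this, abs_mul, abs_of_nonneg (by positivity)]
    have := (abs_add_le (c 1 - c' 1) (c (-1) - c' (-1))).trans (add_le_add (hL _) (hL _))
    nlinarith
  have hq : |(c' (m - 1) + c' (m + 1)) / D'| ≤ 4 := by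
    rw [abs_div, abs_of_pos hDpos', div_le_iff₀ hDpos']
    have := (abs_add_le (c' (m - 1)) (c' (m + 1))).trans (add_le_add (hc' _) (hc' _))
    linarith
  rw [key, abs_div, abs_of_pos hDpos, div_le_iff₀ hDpos, abs_mul, abs_of_nonneg (by positivity)]
  have h1 := (abs_add_le (c (m - 1) - c' (m - 1)) (c (m + 1) - c' (m + 1))).trans
    (add_le_add (hL _) (hL _))
  have h2 : |(c' (m - 1) + c' (m + 1)) / D' * (D - D')| ≤ 4 * (p * L) := by
    rw [abs_mul]
    exact mul_le_mul hq hDD (abs_nonneg _) (by norm_num)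
  have h3 := (abs_sub (c (m - 1) - c' (m - 1) + (c (m + 1) - c' (m + 1)))
    ((c' (m - 1) + c' (m + 1)) / D' * (D - D'))).trans (add_le_add h1 h2)
  have h4 : p * L ≤ 1 / 100 * L := mul_le_mul_of_nonneg_right hp hL0
  calc _ ≤ p / 2 * (L + L + 4 * (p * L)) := mul_le_mul_of_nonneg_left h3 (by positivity)
    _ ≤ (1 / 100) / 2 * (L + L + 4 * (1 / 100 * L)) := by gcongr
    _ ≤ 1 / 2 * L * (1 / 2) := by linarith
    _ ≤ 1 / 2 * L * D := by gcongr

/-- The normalized bounded solution of the recurrence, obtained from the contraction principle on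
the unit ball of `ℓ^∞(ℤ, ℝ)`. -/
theorem exists_recurrence_solution {s p : ℝ} (hs : |s| ≤ 1 / 100) (hp0 : 0 ≤ p)
    (hp : p ≤ 1 / 100) :
    ∃ c : ℤ → ℝ, c 0 = 1 ∧ (∀ m, |c m| ≤ 1) ∧ ∀ m : ℤ, m ≠ 0 →
      ((m : ℝ) ^ 2 + 2 * m * s + p / 2 * (c 1 + c (-1))) * c m
        = p / 2 * (c (m - 1) + c (m + 1)) := by
  let X := Metric.closedBall (0 : BoundedContinuousFunction ℤ ℝ) 1
  have : CompleteSpace X := Metric.isClosed_closedBall.completeSpace_coe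
  have hX : ∀ (f : X) (m : ℤ), |f.1 m| ≤ 1 := fun f m =>
    (f.1.norm_coe_le_norm m).trans (mem_closedBall_zero_iff.1 f.2)
  let T : X → X := fun f =>
    ⟨BoundedContinuousFunction.ofNormedAddCommGroupDiscrete (recurrenceStep s p f.1) 1
        (abs_recurrenceStep_le hs hp0 hp (hX f)),
      mem_closedBall_zero_iff.2 <| (BoundedContinuousFunction.norm_le zero_le_one).2
        (abs_recurrenceStep_le hs hp0 hp (hX f))⟩
  have hT : ContractingWith (1 / 2) T := by
    refine ⟨by norm_num, LipschitzWith.of_dist_le_mul fun f g => ?_⟩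
    refine (BoundedContinuousFunction.dist_le (by positivity)).2 fun m => ?_
    have := abs_recurrenceStep_sub_le hs hp0 hp (hX f) (hX g) (L := dist f g)
      (fun k => BoundedContinuousFunction.dist_coe_le_dist (f := f.1) (g := g.1) k) m
    rw [NNReal.coe_div, NNReal.coe_one, NNReal.coe_two]
    exact this
  have : Nonempty X := ⟨⟨0, by simp [X]⟩⟩
  let f : X := ContractingWith.fixedPoint T hT
  have hf : T f = f := hT.fixedPoint_isFixedPt
  have hfm : ∀ m, recurrenceStep s p f.1 m = f.1 m := fun m =>
    congrArg (fun g : X => g.1 m) hf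
  refine ⟨f.1, ?_, hX f, fun m hm => ?_⟩
  · rw [← hfm 0]
    simp [recurrenceStep]
  · have hD := half_le_denominator hs hp0 hp (hX f 1) (hX f (-1)) hm
    have h := hfm m
    rw [recurrenceStep, if_neg hm, div_eq_iff (by linarith)] at h
    linarith

/-- Solutions of the recurrence decay geometrically away from `m = 0`: one factor `2 * p` for
each step. -/
theorem abs_le_pow_of_recurrence {s p : ℝ} (hs : |s| ≤ 1 / 100) (hp0 : 0 ≤ p) (hp : p ≤ 1 / 100)
    {c : ℤ → ℝ} (hc : ∀ m, |c m| ≤ 1)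
    (hrec : ∀ m : ℤ, m ≠ 0 → ((m : ℝ) ^ 2 + 2 * m * s + p / 2 * (c 1 + c (-1))) * c m
        = p / 2 * (c (m - 1) + c (m + 1))) (m : ℤ) :
    |c m| ≤ (2 * p) ^ m.natAbs := by
  suffices H : ∀ (j : ℕ) (m : ℤ), j ≤ m.natAbs → |c m| ≤ (2 * p) ^ j from H _ m le_rfl
  intro j
  induction j with
  | zero => intro m _; simpa using hc m
  | succ j ih =>
    intro m hj
    have hm : m ≠ 0 := by rintro rfl; simp at hj
    have hD := half_le_denominator hs hp0 hp (hc 1) (hc (-1)) hm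
    have h := congrArg abs (hrec m hm)
    rw [abs_mul, abs_mul, abs_of_nonneg (le_trans (by norm_num) hD),
      abs_of_nonneg (by positivity : 0 ≤ p / 2)] at h
    have h1 := (abs_add_le (c (m - 1)) (c (m + 1))).trans
      (add_le_add (ih (m - 1) (by omega)) (ih (m + 1) (by omega)))
    have h2 : 1 / 2 * |c m| ≤ p / 2 * ((2 * p) ^ j + (2 * p) ^ j) :=
      (mul_le_mul_of_nonneg_right hD (abs_nonneg _)).trans
        (h.le.trans (mul_le_mul_of_nonneg_left h1 (by positivity)))
    rw [pow_succ]
    linarith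

/-- First-order perturbation theory for the two coefficients next to `m = 0`. -/
theorem abs_sub_half_le_of_recurrence {s p ρ : ℝ} (hs : |s| ≤ ρ) (hp0 : 0 ≤ p) (hp : p ≤ ρ)
    (hρ : ρ ≤ 1 / 100) {c : ℤ → ℝ} (hc0 : c 0 = 1) (hc : ∀ m, |c m| ≤ 1)
    (hrec : ∀ m : ℤ, m ≠ 0 → ((m : ℝ) ^ 2 + 2 * m * s + p / 2 * (c 1 + c (-1))) * c m
        = p / 2 * (c (m - 1) + c (m + 1))) :
    |c 1 - p / 2| ≤ 3 * p * ρ ∧ |c (-1) - p / 2| ≤ 3 * p * ρ := by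
  have hs' := hs.trans hρ
  have hp' := hp.trans hρ
  have hb := abs_le_pow_of_recurrence hs' hp0 hp' hc hrec
  have h1 : |c 1| ≤ 2 * p := by simpa using hb 1
  have h1' : |c (-1)| ≤ 2 * p := by simpa using hb (-1)
  have h2 : |c 2| ≤ (2 * p) ^ 2 := by simpa using hb 2
  have h2' : |c (-2)| ≤ (2 * p) ^ 2 := by simpa using hb (-2)
  have hD := half_le_denominator hs' hp0 hp' (hc 1) (hc (-1)) (m := 1) (by norm_num)
  have hD' := half_le_denominator hs' hp0 hp' (hc 1) (hc (-1)) (m := -1) (by norm_num)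
  have e := hrec 1 (by norm_num)
  have e' := hrec (-1) (by norm_num)
  norm_num [hc0] at e e' hD hD'
  have hsum : |p / 2 * (c 1 + c (-1))| ≤ 2 * p ^ 2 := by
    rw [abs_mul, abs_of_nonneg (by positivity)]
    nlinarith [abs_add_le (c 1) (c (-1))]
  -- A common estimate: `D * x = p / 2 * (1 + y)` with `D = 1 + t` and `t`, `y` small.
  have aux : ∀ D x y t : ℝ, 1 / 2 ≤ D → D = 1 + t → |t| ≤ 2 * ρ + 2 * p ^ 2 →
      |y| ≤ (2 * p) ^ 2 → D * x = p / 2 * (1 + y) → |x - p / 2| ≤ 3 * p * ρ := by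
    intro D x y t hD hDt ht hy h
    have h5 : D * (x - p / 2) = p / 2 * (y - t) := by rw [mul_sub, h, hDt]; ring
    have h6 := congrArg abs h5
    rw [abs_mul, abs_mul, abs_of_nonneg (by linarith : 0 ≤ D),
      abs_of_nonneg (by positivity : 0 ≤ p / 2)] at h6
    have h7 : |y - t| ≤ 3 * ρ := by
      refine (abs_sub y t).trans ?_
      nlinarith
    have h8 : 1 / 2 * |x - p / 2| ≤ D * |x - p / 2| :=
      mul_le_mul_of_nonneg_right hD (abs_nonneg _)
    have h9 : p / 2 * |y - t| ≤ p / 2 * (3 * ρ) := mul_le_mul_of_nonneg_left h7 (by positivity)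
    linarith
  have ht : ∀ σ : ℝ, |σ| = 1 →
      |2 * σ * s + p / 2 * (c 1 + c (-1))| ≤ 2 * ρ + 2 * p ^ 2 := by
    intro σ hσ
    refine (abs_add_le _ _).trans (add_le_add ?_ hsum)
    rw [abs_mul, abs_mul, hσ]
    norm_num
    exact hs
  constructor
  · exact aux (1 + 2 * s + p / 2 * (c 1 + c (-1))) _ (c 2)
      (2 * 1 * s + p / 2 * (c 1 + c (-1))) (by linarith) (by ring)
      (ht 1 (by norm_num)) h2 e
  · exact aux (1 + -(2 * s) + p / 2 * (c 1 + c (-1))) _ (c (-2))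
      (2 * (-1) * s + p / 2 * (c 1 + c (-1))) (by linarith) (by ring)
      (ht (-1) (by norm_num)) h2' (by linarith)

/-- A bounded solution of a recurrence with small coupling vanishes if its central term is at
most half of its supremum. -/
theorem eq_zero_of_recurrence {p : ℝ} (hp0 : 0 ≤ p) (hp : p ≤ 1 / 100) {d : ℤ → ℝ}
    (hd : ∀ m ≠ 0, 1 / 2 ≤ d m) {a : ℤ → ℂ} {B : ℝ} (hB : ∀ m, ‖a m‖ ≤ B)
    (hrec : ∀ m ≠ 0, (d m : ℂ) * a m = (p / 2 : ℝ) * (a (m - 1) + a (m + 1)))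
    (h0 : ∀ K : ℝ, (∀ m, ‖a m‖ ≤ K) → ‖a 0‖ ≤ K / 2) : ∀ m, a m = 0 := by
  have step : ∀ K : ℝ, (∀ m, ‖a m‖ ≤ K) → ∀ m, ‖a m‖ ≤ K / 2 := by
    intro K hK m
    by_cases hm : m = 0
    · exact hm ▸ h0 K hK
    have h := congrArg norm (hrec m hm)
    rw [norm_mul, norm_mul, Complex.norm_of_nonneg (by linarith [hd m hm]),
      Complex.norm_of_nonneg (by positivity)] at h
    have h1 := (norm_add_le (a (m - 1)) (a (m + 1))).trans (add_le_add (hK _) (hK _))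
    have h2 := mul_le_mul_of_nonneg_right (hd m hm) (norm_nonneg (a m))
    have hK0 : 0 ≤ K := (norm_nonneg _).trans (hK 0)
    have h3 : p / 2 * ‖a (m - 1) + a (m + 1)‖ ≤ (1 / 100) / 2 * (K + K) := by gcongr
    linarith
  have H : ∀ (j : ℕ) (m : ℤ), ‖a m‖ ≤ B * (1 / 2) ^ j := by
    intro j
    induction j with
    | zero => simpa using hB
    | succ j ih =>
      intro m
      refine (step _ ih m).trans (le_of_eq ?_)
      ring
  intro m
  have hlim : Tendsto (fun j : ℕ => B * (1 / 2 : ℝ) ^ j) atTop (𝓝 0) := by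
    simpa using (tendsto_pow_atTop_nhds_zero_of_lt_one (by norm_num : (0 : ℝ) ≤ 1 / 2)
      (by norm_num)).const_mul B
  exact norm_le_zero_iff.1 (ge_of_tendsto' hlim fun j => H j m)

theorem hasSum_half_pow_natAbs : HasSum (fun m : ℤ => (1 / 2 : ℝ) ^ m.natAbs) 3 := by
  have h : HasSum (fun n : ℕ => (1 / 2 : ℝ) ^ n) 2 := hasSum_geometric_two
  have h1 : HasSum (fun n : ℕ => (1 / 2 : ℝ) ^ (n + 1)) 1 := by
    have h' := h.mul_right (1 / 2)
    simp only [← pow_succ] at h'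
    norm_num at h' ⊢
    exact h'
  have := HasSum.of_nat_of_neg_add_one (f := fun m : ℤ => (1 / 2 : ℝ) ^ m.natAbs)
    (m := 2) (m' := 1) (by simpa using h) (by
      convert h1 using 3 with n
      omega)
  norm_num at this ⊢
  exact this

theorem summable_natAbs_pow_mul_half_pow (k : ℕ) :
    Summable fun m : ℤ => (m.natAbs : ℝ) ^ k * (1 / 2 : ℝ) ^ m.natAbs := by
  have h : Summable fun n : ℕ => (n : ℝ) ^ k * (1 / 2 : ℝ) ^ n :=
    summable_pow_mul_geometric_of_norm_lt_one k (by norm_num)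
  exact Summable.of_nat_of_neg (by simpa using h) (by simpa using h)

/-- Bounded solutions of the recurrences for two distinct spectral parameters are orthogonal, if
one of them is summable; the sum of the off-diagonal terms telescopes. -/
theorem hasSum_mul_zero_of_recurrence {p : ℝ} {d d' : ℤ → ℝ} {ν : ℝ} (hν : ν ≠ 0)
    (hdd : ∀ m, d' m - d m = ν) {a c : ℤ → ℂ} {B : ℝ} (hB : ∀ m, ‖a m‖ ≤ B)
    (hc : Summable fun m => ‖c m‖)
    (ha : ∀ m, (d' m : ℂ) * a m = (p / 2 : ℝ) * (a (m - 1) + a (m + 1)))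
    (hrec : ∀ m, (d m : ℂ) * c m = (p / 2 : ℝ) * (c (m - 1) + c (m + 1))) :
    HasSum (fun m => a m * c m) 0 := by
  have hs1 : Summable fun m => a (m - 1) * c m :=
    Summable.of_norm_bounded (hc.mul_left B) fun m => by
      rw [norm_mul]; exact mul_le_mul_of_nonneg_right (hB _) (norm_nonneg _)
  have hs2 : Summable fun m => a m * c (m - 1) := by
    refine Summable.of_norm_bounded
      (((Equiv.subRight (1 : ℤ)).summable_iff.2 hc).mul_left B) fun m => ?_
    rw [norm_mul]
    exact mul_le_mul_of_nonneg_right (hB _) (norm_nonneg _)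
  have hh := (hs1.sub hs2).hasSum
  have hh' := (Equiv.addRight (1 : ℤ)).hasSum_iff.2 hh
  have hd := ((hh.sub hh').mul_left ((p / 2 : ℝ) : ℂ)).mul_left ((ν : ℂ)⁻¹)
  rw [sub_self, mul_zero, mul_zero] at hd
  refine (congrArg (HasSum · (0 : ℂ)) (funext fun m => ?_)).mpr hd
  have hν' : (ν : ℂ) ≠ 0 := by exact_mod_cast hν
  rw [eq_inv_mul_iff_mul_eq₀ hν', ← hdd m]
  have e1 := ha m
  have e2 := hrec m
  simp only [Function.comp_apply, Equiv.coe_addRight, add_sub_cancel_right]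
  push_cast at e1 e2 ⊢
  linear_combination c m * e1 - a m * e2

/-! ### Rapidly converging trigonometric series -/

/-- The trigonometric series with coefficients `a`. -/
noncomputable def trigSeries (a : ℤ → ℂ) (x : ℝ) : ℂ :=
  ∑' m : ℤ, a m * Complex.exp (Complex.I * (m * x))

/-- The coefficients decay faster than any power of the frequency. -/
def RapidDecay (a : ℤ → ℂ) : Prop :=
  ∀ k : ℕ, Summable fun m : ℤ => (m.natAbs : ℝ) ^ k * ‖a m‖

theorem norm_exp_I_mul_ofReal (t : ℝ) : ‖Complex.exp (Complex.I * t)‖ = 1 := by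
  rw [mul_comm, Complex.norm_exp_ofReal_mul_I]

theorem norm_exp_I_mul_int_mul (m : ℤ) (x : ℝ) : ‖Complex.exp (Complex.I * (m * x))‖ = 1 := by
  simpa using norm_exp_I_mul_ofReal (m * x)

theorem RapidDecay.of_le {a : ℤ → ℂ} {K : ℝ} (h : ∀ m, ‖a m‖ ≤ K * (1 / 2) ^ m.natAbs) :
    RapidDecay a := fun k => by
  refine Summable.of_nonneg_of_le (fun m => by positivity) (fun m => ?_)
    ((summable_natAbs_pow_mul_half_pow k).mul_left K)
  calc _ ≤ (m.natAbs : ℝ) ^ k * (K * (1 / 2) ^ m.natAbs) := by gcongr; exact h m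
    _ = _ := by ring

theorem norm_I_mul_intCast (m : ℤ) : ‖Complex.I * (m : ℂ)‖ = (m.natAbs : ℝ) := by
  rw [norm_mul, Complex.norm_I, one_mul, Complex.norm_intCast, Nat.cast_natAbs, Int.cast_abs]

theorem RapidDecay.pow_mul {a : ℤ → ℂ} (h : RapidDecay a) (j : ℕ) :
    RapidDecay fun m => (Complex.I * m) ^ j * a m := fun k => by
  convert h (k + j) using 2 with m
  rw [norm_mul, norm_pow, norm_I_mul_intCast, pow_add, mul_assoc]

theorem RapidDecay.summable_norm {a : ℤ → ℂ} (h : RapidDecay a) : Summable fun m => ‖a m‖ := by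
  simpa using h 0

theorem RapidDecay.hasSum {a : ℤ → ℂ} (h : RapidDecay a) (x : ℝ) :
    HasSum (fun m : ℤ => a m * Complex.exp (Complex.I * (m * x))) (trigSeries a x) := by
  refine Summable.hasSum (Summable.of_norm ?_)
  simpa [norm_exp_I_mul_int_mul] using h.summable_norm

theorem RapidDecay.hasDerivAt {a : ℤ → ℂ} (h : RapidDecay a) (x : ℝ) :
    HasDerivAt (trigSeries a) (trigSeries (fun m => Complex.I * m * a m) x) x := by
  have h1 := h.pow_mul 1
  simp only [pow_one] at h1
  have hg : ∀ (m : ℤ) (y : ℝ), HasDerivAt (fun y : ℝ => a m * Complex.exp (Complex.I * (m * y)))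
      (Complex.I * m * a m * Complex.exp (Complex.I * (m * y))) y := by
    intro m y
    have h0 : HasDerivAt (fun y : ℝ => (y : ℂ)) 1 y := (hasDerivAt_id y).ofReal_comp
    have h2 := (((h0.const_mul (m : ℂ)).const_mul Complex.I).cexp).const_mul (a m)
    exact h2.congr_deriv (by ring)
  exact hasDerivAt_tsum h1.summable_norm hg
    (fun m y => by rw [norm_mul, norm_exp_I_mul_int_mul, mul_one]) (h.hasSum 0).summable x

theorem RapidDecay.iteratedDeriv_eq {a : ℤ → ℂ} (h : RapidDecay a) (k : ℕ) :
    iteratedDeriv k (trigSeries a) = trigSeries fun m => (Complex.I * m) ^ k * a m := by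
  induction k with
  | zero => simp
  | succ k ih =>
    rw [iteratedDeriv_succ, ih]
    funext x
    rw [((h.pow_mul k).hasDerivAt x).deriv]
    congr 1
    funext m
    ring

theorem RapidDecay.contDiff {a : ℤ → ℂ} (h : RapidDecay a) : ContDiff ℝ ∞ (trigSeries a) := by
  refine contDiff_of_differentiable_iteratedDeriv fun k _ => ?_
  rw [h.iteratedDeriv_eq]
  exact fun x => ((h.pow_mul k).hasDerivAt x).differentiableAt

theorem trigSeries_periodic (a : ℤ → ℂ) : Function.Periodic (trigSeries a) (2 * π) := by
  intro x
  refine tsum_congr fun m => ?_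
  congr 1
  rw [Complex.exp_eq_exp_iff_exists_int]
  exact ⟨m, by push_cast; ring⟩

theorem norm_iteratedDeriv_trigSeries_le {a : ℤ → ℂ} {K : ℝ}
    (h : ∀ m, ‖a m‖ ≤ K * (1 / 2) ^ m.natAbs) (k : ℕ) (x : ℝ) :
    ‖iteratedDeriv k (trigSeries a) x‖
      ≤ K * ∑' m : ℤ, (m.natAbs : ℝ) ^ k * (1 / 2 : ℝ) ^ m.natAbs := by
  rw [(RapidDecay.of_le h).iteratedDeriv_eq]
  refine tsum_of_norm_bounded ((summable_natAbs_pow_mul_half_pow k).hasSum.mul_left K) fun m => ?_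
  rw [norm_mul, norm_exp_I_mul_int_mul, mul_one, norm_mul, norm_pow, norm_I_mul_intCast]
  calc _ ≤ (m.natAbs : ℝ) ^ k * (K * (1 / 2) ^ m.natAbs) := by gcongr; exact h m
    _ = _ := by ring

/-- Multiplication by `2 * cos x` acts on the coefficients as the sum of the two unit shifts. -/
theorem RapidDecay.hasSum_two_cos_mul {a : ℤ → ℂ} (h : RapidDecay a) (x : ℝ) :
    HasSum (fun m : ℤ => (a (m - 1) + a (m + 1)) * Complex.exp (Complex.I * (m * x)))
      (((2 * cos x : ℝ) : ℂ) * trigSeries a x) := by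
  have e : ((2 * cos x : ℝ) : ℂ) = Complex.exp (Complex.I * x) + Complex.exp (-(Complex.I * x)) := by
    push_cast
    rw [Complex.two_cos, mul_comm (x : ℂ), neg_mul, mul_comm (x : ℂ)]
  have h1 := (Equiv.subRight (1 : ℤ)).hasSum_iff.2
    ((h.hasSum x).mul_left (Complex.exp (Complex.I * x)))
  have h2 := (Equiv.addRight (1 : ℤ)).hasSum_iff.2
    ((h.hasSum x).mul_left (Complex.exp (-(Complex.I * x))))
  rw [e, add_mul]
  refine (congrArg (HasSum · _) (funext fun m => ?_)).mpr (h1.add h2)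
  simp only [Function.comp_apply, Equiv.coe_addRight, Equiv.subRight_apply]
  have e1 : Complex.exp (Complex.I * (m * x))
      = Complex.exp (Complex.I * x) * Complex.exp (Complex.I * ((m - 1 : ℤ) * x)) := by
    rw [← Complex.exp_add]; push_cast; ring_nf
  have e2 : Complex.exp (Complex.I * (m * x))
      = Complex.exp (-(Complex.I * x)) * Complex.exp (Complex.I * ((m + 1 : ℤ) * x)) := by
    rw [← Complex.exp_add]; push_cast; ring_nf
  rw [add_mul]
  nth_rewrite 1 [e1]
  rw [e2]
  ring

/-! ### Functions on the circle -/

instance : IsFiniteMeasure periodMeasure := by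
  unfold periodMeasure
  infer_instance

theorem integral_periodMeasure {E : Type*} [NormedAddCommGroup E] [NormedSpace ℝ E] (f : ℝ → E) :
    ∫ x, f x ∂periodMeasure = ∫ x in (0 : ℝ)..2 * π, f x :=
  (intervalIntegral.integral_of_le Real.two_pi_pos.le).symm

theorem integrable_periodMeasure {E : Type*} [NormedAddCommGroup E] {f : ℝ → E}
    (hf : Continuous f) : Integrable f periodMeasure :=
  (hf.integrableOn_Icc (a := 0) (b := 2 * π)).mono_set Set.Ioc_subset_Icc_self

theorem memL2Circle_of_continuous {f : ℝ → ℂ} (hf : Continuous f)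
    (hp : Function.Periodic f (2 * π)) : MemL2Circle f := by
  refine ⟨hp, ?_⟩
  obtain ⟨B, hB⟩ := isCompact_Icc.exists_bound_of_continuousOn
    (s := Set.Icc (0 : ℝ) (2 * π)) hf.continuousOn
  refine MemLp.of_bound hf.aestronglyMeasurable B ?_
  exact (ae_restrict_iff' measurableSet_Ioc).2 (ae_of_all _ fun x hx => hB x ⟨hx.1.le, hx.2⟩)

theorem MemL2Circle.integrable_mul {f g : ℝ → ℂ} (hf : MemL2Circle f) (hg : Continuous g) {B : ℝ}
    (hB : ∀ x, ‖g x‖ ≤ B) : Integrable (fun x => f x * g x) periodMeasure :=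
  (hf.2.integrable (by norm_num)).mul_bdd hg.aestronglyMeasurable (ae_of_all _ hB)

theorem isWeakDerivCircle_of_hasDerivAt {f f' : ℝ → ℂ} (hf : ∀ x, HasDerivAt f (f' x) x)
    (hf' : Continuous f') (hp : Function.Periodic f (2 * π)) : IsWeakDerivCircle f f' := by
  intro ψ hψ hψp
  have hψ1 : ContDiff ℝ 1 ψ := hψ.of_le (by exact_mod_cast le_top)
  rw [integral_periodMeasure, integral_periodMeasure,
    intervalIntegral.integral_mul_deriv_eq_deriv_mul (u := f) (v := ψ) (fun x _ => hf x)
      (fun x _ => (hψ1.differentiable one_ne_zero x).hasDerivAt)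
      (hf'.intervalIntegrable _ _) ((hψ1.continuous_deriv le_rfl).intervalIntegrable _ _)]
  have e1 := hp 0
  have e2 := hψp 0
  rw [zero_add] at e1 e2
  rw [e1, e2, sub_self, zero_sub]

/-- The test functions `e^{i n x} e^{-i m (x - θ)}`: conjugating with `e^{i n x}` brings the
quasi-momentum near `0`, the translation by `θ` turns the potential into a pure cosine. -/
noncomputable def circleMode (n : ℤ) (θ : ℝ) (m : ℤ) (x : ℝ) : ℂ :=
  Complex.exp (Complex.I * (n * x - m * (x - θ)))

theorem hasDerivAt_circleMode (n : ℤ) (θ : ℝ) (m : ℤ) (x : ℝ) :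
    HasDerivAt (circleMode n θ m) (Complex.I * (n - m) * circleMode n θ m x) x := by
  have h0 : HasDerivAt (fun y : ℝ => (y : ℂ)) 1 x := (hasDerivAt_id x).ofReal_comp
  have h2 : HasDerivAt (fun y : ℝ => Complex.I * ((n : ℂ) * (y : ℂ) - m * ((y : ℂ) - θ)))
      (Complex.I * (n - m)) x := by
    simpa using ((h0.const_mul (n : ℂ)).sub ((h0.sub_const (θ : ℂ)).const_mul (m : ℂ))).const_mul
      Complex.I
  exact h2.cexp.congr_deriv (mul_comm _ _)

theorem contDiff_circleMode (n : ℤ) (θ : ℝ) (m : ℤ) : ContDiff ℝ ∞ (circleMode n θ m) := by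
  have : ContDiff ℝ ∞ (fun x : ℝ => (x : ℂ)) := Complex.ofRealCLM.contDiff
  unfold circleMode
  fun_prop

theorem circleMode_periodic (n : ℤ) (θ : ℝ) (m : ℤ) :
    Function.Periodic (circleMode n θ m) (2 * π) := by
  intro x
  rw [circleMode, circleMode, Complex.exp_eq_exp_iff_exists_int]
  exact ⟨n - m, by push_cast; ring⟩

theorem norm_circleMode (n : ℤ) (θ : ℝ) (m : ℤ) (x : ℝ) : ‖circleMode n θ m x‖ = 1 := by
  have := norm_exp_I_mul_ofReal (n * x - m * (x - θ))
  rw [circleMode]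
  exact_mod_cast this

theorem MemL2Circle.integrable_mul_circleMode {f : ℝ → ℂ} (hf : MemL2Circle f) (n : ℤ) (θ : ℝ)
    (m : ℤ) : Integrable (fun x => f x * circleMode n θ m x) periodMeasure :=
  hf.integrable_mul (contDiff_circleMode n θ m).continuous fun x => (norm_circleMode n θ m x).le

theorem IsWeakDerivCircle.integral_mul_circleMode {f g : ℝ → ℂ} (h : IsWeakDerivCircle f g)
    (n : ℤ) (θ : ℝ) (m : ℤ) :
    ∫ x, g x * circleMode n θ m x ∂periodMeasure
      = -(Complex.I * (n - m)) * ∫ x, f x * circleMode n θ m x ∂periodMeasure := by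
  have h1 := h _ (contDiff_circleMode n θ m) (circleMode_periodic n θ m)
  have h2 : ∀ x, f x * deriv (circleMode n θ m) x
      = Complex.I * (n - m) * (f x * circleMode n θ m x) := fun x => by
    rw [(hasDerivAt_circleMode n θ m x).deriv]; ring
  simp only [h2, integral_const_mul] at h1
  rw [neg_mul, h1, neg_neg]

theorem norm_integral_mul_circleMode_le {f : ℝ → ℂ} (n : ℤ) (θ : ℝ) (m : ℤ) :
    ‖∫ x, f x * circleMode n θ m x ∂periodMeasure‖ ≤ ∫ x, ‖f x‖ ∂periodMeasure := by
  refine (norm_integral_le_integral_norm _).trans (le_of_eq ?_)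
  simp [norm_circleMode]

/-- A square-integrable function orthogonal to all modes vanishes (Parseval). -/
theorem MemL2Circle.ae_eq_zero {f : ℝ → ℂ} (hf : MemL2Circle f) (n : ℤ) (θ : ℝ)
    (h : ∀ m, ∫ x, f x * circleMode n θ m x ∂periodMeasure = 0) : f =ᵐ[periodMeasure] 0 := by
  have hcoef : ∀ k, fourierCoeffOn Real.two_pi_pos f k = 0 := by
    intro k
    rw [fourierCoeffOn_eq_integral]
    have e : ∀ x : ℝ, fourier (-k) (x : AddCircle (2 * π - 0)) • f x
        = Complex.exp (-(Complex.I * ((n + k) * θ))) * (f x * circleMode n θ (n + k) x) := by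
      intro x
      rw [fourier_coe_apply, smul_eq_mul, mul_left_comm, mul_comm (f x), circleMode,
        ← Complex.exp_add]
      congr 2
      have : (π : ℂ) ≠ 0 := by exact_mod_cast Real.pi_ne_zero
      push_cast
      field_simp
      ring
    simp only [e, intervalIntegral.integral_const_mul]
    rw [← integral_periodMeasure, h, mul_zero, smul_zero]
  have hP := tsum_sq_fourierCoeffOn Real.two_pi_pos hf.2
  simp only [hcoef, norm_zero, ne_eq, OfNat.ofNat_ne_zero, not_false_eq_true, zero_pow,
    tsum_zero] at hP
  have hI : ∫ x, ‖f x‖ ^ 2 ∂periodMeasure = 0 := by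
    rw [integral_periodMeasure]
    have : (2 * π - 0 : ℝ)⁻¹ ≠ 0 := by
      rw [sub_zero]; exact inv_ne_zero Real.two_pi_pos.ne'
    exact (smul_eq_zero.1 hP.symm).resolve_left this
  have hint : Integrable (fun x => ‖f x‖ ^ 2) periodMeasure := by
    simpa using hf.2.integrable_norm_pow (by norm_num)
  have := (integral_eq_zero_iff_of_nonneg (fun x => by positivity) hint).1 hI
  filter_upwards [this] with x hx
  simpa using hx

/-! ### The ground state in sequence space -/

/-- Existence of the eigenpair with `c 0 = 1`, with its expansion to the first orders. -/
theorem exists_ground_sequence {s p ρ : ℝ} (hs : |s| ≤ ρ) (hp0 : 0 ≤ p) (hp : p ≤ ρ)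
    (hρ : ρ ≤ 1 / 100) :
    ∃ (c : ℤ → ℝ) (μ : ℝ), c 0 = 1 ∧ (∀ m, |c m| ≤ (2 * p) ^ m.natAbs) ∧
      |c 1 - p / 2| ≤ 3 * p * ρ ∧ |c (-1) - p / 2| ≤ 3 * p * ρ ∧
      (∀ m : ℤ, ((m + s) ^ 2 + p ^ 2 - μ) * c m = p / 2 * (c (m - 1) + c (m + 1))) ∧
      |μ - (s ^ 2 + 1 / 2 * p ^ 2)| ≤ 3 * ρ ^ 3 ∧ μ ≤ 1 / 4 := by
  obtain ⟨c, hc0, hc, hrec⟩ := exists_recurrence_solution (hs.trans hρ) hp0 (hp.trans hρ)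
  obtain ⟨h1, h2⟩ := abs_sub_half_le_of_recurrence hs hp0 hp hρ hc0 hc hrec
  have hρ0 : 0 ≤ ρ := hp0.trans hp
  have hμ : |s ^ 2 + p ^ 2 - p / 2 * (c 1 + c (-1)) - (s ^ 2 + 1 / 2 * p ^ 2)| ≤ 3 * ρ ^ 3 := by
    have e : s ^ 2 + p ^ 2 - p / 2 * (c 1 + c (-1)) - (s ^ 2 + 1 / 2 * p ^ 2)
        = -(p / 2 * ((c 1 - p / 2) + (c (-1) - p / 2))) := by ring
    rw [e, abs_neg, abs_mul, abs_of_nonneg (by positivity)]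
    have h3 := (abs_add_le _ _).trans (add_le_add h1 h2)
    calc _ ≤ p / 2 * (3 * p * ρ + 3 * p * ρ) := mul_le_mul_of_nonneg_left h3 (by positivity)
      _ = 3 * (p ^ 2 * ρ) := by ring
      _ ≤ 3 * (ρ ^ 2 * ρ) := by gcongr
      _ = _ := by ring
  refine ⟨c, s ^ 2 + p ^ 2 - p / 2 * (c 1 + c (-1)), hc0,
    abs_le_pow_of_recurrence (hs.trans hρ) hp0 (hp.trans hρ) hc hrec, h1, h2, ?_, hμ, ?_⟩
  · intro m
    by_cases hm : m = 0
    · subst hm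
      simp only [Int.cast_zero, zero_add, zero_sub, hc0]
      ring
    · rw [← hrec m hm]
      ring
  · have h4 : s ^ 2 ≤ (1 / 100) ^ 2 := sq_le_sq' (by linarith [neg_abs_le s])
      (by linarith [le_abs_self s])
    have h5 : p ^ 2 ≤ (1 / 100) ^ 2 := by gcongr; exact hp.trans hρ
    have h6 : ρ ^ 3 ≤ (1 / 100) ^ 3 := by gcongr
    have := (abs_le.1 hμ).2
    norm_num at h4 h5 h6 ⊢
    linarith

theorem half_le_shifted_sq_sub {s p μ : ℝ} (hs : |s| ≤ 1 / 100) (hμ : μ ≤ 1 / 4) (m : ℤ)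
    (hm : m ≠ 0) : 1 / 2 ≤ ((m : ℝ) + s) ^ 2 + p ^ 2 - μ := by
  have := three_quarters_le_denominator (p := 0) (x := 0) (y := 0) hs le_rfl (by norm_num)
    (by norm_num) (by norm_num) hm
  nlinarith [sq_nonneg s, sq_nonneg p]

/-- At the ground-state parameter, the bounded solutions are the multiples of the ground state. -/
theorem eq_mul_of_ground_recurrence {s p μ : ℝ} (hs : |s| ≤ 1 / 100) (hp0 : 0 ≤ p)
    (hp : p ≤ 1 / 100) (hμ : μ ≤ 1 / 4) {c : ℤ → ℝ} (hc0 : c 0 = 1)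
    (hc : ∀ m, |c m| ≤ (2 * p) ^ m.natAbs)
    (hrec : ∀ m : ℤ, ((m + s) ^ 2 + p ^ 2 - μ) * c m = p / 2 * (c (m - 1) + c (m + 1)))
    {a : ℤ → ℂ} {B : ℝ} (hB : ∀ m, ‖a m‖ ≤ B)
    (ha : ∀ m : ℤ, ((((m : ℝ) + s) ^ 2 + p ^ 2 - μ : ℝ) : ℂ) * a m
      = (p / 2 : ℝ) * (a (m - 1) + a (m + 1))) (m : ℤ) : a m = a 0 * c m := by
  refine sub_eq_zero.1 (eq_zero_of_recurrence (a := fun m => a m - a 0 * c m) (B := B + ‖a 0‖)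
    hp0 hp (fun m hm => half_le_shifted_sq_sub (p := p) hs hμ m hm) (fun m => ?_)
    (fun m _ => ?_) (fun K hK => ?_) m)
  · refine (norm_sub_le _ _).trans (add_le_add (hB m) ?_)
    rw [norm_mul, Complex.norm_real, Real.norm_eq_abs]
    exact mul_le_of_le_one_right (norm_nonneg _)
      ((hc m).trans (pow_le_one₀ (by positivity) (by linarith)))
  · have h := congrArg (fun t : ℝ => (t : ℂ)) (hrec m)
    have h' := ha m
    push_cast at h h' ⊢
    linear_combination h' - a 0 * h
  · have : 0 ≤ K := (norm_nonneg _).trans (hK 0)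
    simp only [hc0, Complex.ofReal_one, mul_one, sub_self, norm_zero]
    positivity

/-- A nonzero bounded solution has its spectral parameter above that of the ground state:
otherwise it would be orthogonal to the ground state, which is concentrated at `m = 0`. -/
theorem le_of_bounded_recurrence {s p μ μ' : ℝ} (hs : |s| ≤ 1 / 100) (hp0 : 0 ≤ p)
    (hp : p ≤ 1 / 100) (hμ : μ ≤ 1 / 4) {c : ℤ → ℝ} (hc0 : c 0 = 1)
    (hc : ∀ m, |c m| ≤ (2 * p) ^ m.natAbs)
    (hrec : ∀ m : ℤ, ((m + s) ^ 2 + p ^ 2 - μ) * c m = p / 2 * (c (m - 1) + c (m + 1)))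
    {a : ℤ → ℂ} {B : ℝ} (hB : ∀ m, ‖a m‖ ≤ B)
    (ha : ∀ m : ℤ, ((((m : ℝ) + s) ^ 2 + p ^ 2 - μ' : ℝ) : ℂ) * a m
      = (p / 2 : ℝ) * (a (m - 1) + a (m + 1))) (hne : ∃ m, a m ≠ 0) : μ ≤ μ' := by
  by_contra! hlt
  have hcm : ∀ m : ℤ, m ≠ 0 → ‖(c m : ℂ)‖ ≤ 1 / 25 * (1 / 2) ^ m.natAbs := by
    intro m hm
    rw [Complex.norm_real, Real.norm_eq_abs]
    obtain ⟨j, hj⟩ : ∃ j, m.natAbs = j + 1 := ⟨m.natAbs - 1, by omega⟩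
    refine (hc m).trans ?_
    rw [hj, pow_succ, pow_succ]
    have : (2 * p) ^ j ≤ (1 / 2) ^ j := pow_le_pow_left₀ (by positivity) (by linarith) j
    have h0 : (0 : ℝ) ≤ (1 / 2) ^ j := by positivity
    nlinarith
  have hsum : Summable fun m => ‖(c m : ℂ)‖ := by
    refine Summable.of_nonneg_of_le (fun m => norm_nonneg _) (fun m => ?_)
      hasSum_half_pow_natAbs.summable
    rw [Complex.norm_real, Real.norm_eq_abs]
    exact (hc m).trans (pow_le_pow_left₀ (by positivity) (by linarith) _)
  have horth := hasSum_mul_zero_of_recurrence (p := p) (ν := μ - μ')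
    (d := fun m : ℤ => ((m : ℝ) + s) ^ 2 + p ^ 2 - μ)
    (d' := fun m : ℤ => ((m : ℝ) + s) ^ 2 + p ^ 2 - μ') (sub_ne_zero.2 hlt.ne')
    (fun m => by ring) (c := fun m => (c m : ℂ)) hB hsum ha (fun m => by exact_mod_cast hrec m)
  obtain ⟨m, hm⟩ := hne
  refine hm (eq_zero_of_recurrence hp0 hp
    (fun m hm => half_le_shifted_sq_sub (p := p) hs (hlt.le.trans hμ) m hm) hB
    (fun m _ => ha m) (fun K hK => ?_) m)
  have hK0 : 0 ≤ K := (norm_nonneg _).trans (hK 0)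
  have h1 := horth.update 0 0
  simp only [zero_sub, add_zero] at h1
  have h2 := h1.tsum_eq ▸ tsum_of_norm_bounded (a := 3 * (1 / 25) * K)
    (f := Function.update (fun m => a m * (c m : ℂ)) 0 0)
    (g := fun m : ℤ => (1 / 2 : ℝ) ^ m.natAbs * (1 / 25) * K)
    ((hasSum_half_pow_natAbs.mul_right _).mul_right _) (fun m => by
      by_cases hm : m = 0
      · subst hm
        simpa using by positivity
      · rw [Function.update_of_ne hm, norm_mul]
        have := mul_le_mul (hK m) (hcm m hm) (norm_nonneg _) hK0
        linarith)
  simp only [hc0, Complex.ofReal_one, mul_one, norm_neg] at h2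
  linarith

/-! ### The operator in Fourier coefficients -/

theorem exists_phase {d : ℕ} (hd : d = 2 ∨ d = 3) (ξ : WaveNumber d) :
    ∃ θ : ℝ, ∀ x, fibrePotential ξ x = ‖ξ.2‖ * cos (x - θ) := by
  have polar : ∀ a b r : ℝ, r = √(a ^ 2 + b ^ 2) →
      ∃ θ : ℝ, ∀ x, a * cos x + b * sin x = r * cos (x - θ) := by
    intro a b r hr
    refine ⟨Complex.arg ⟨a, b⟩, fun x => ?_⟩
    have hn : ‖(⟨a, b⟩ : ℂ)‖ = r := by rw [Complex.norm_def, Complex.normSq_mk, hr]; ring_nf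
    have h1 := Complex.norm_mul_cos_arg ⟨a, b⟩
    have h2 := Complex.norm_mul_sin_arg ⟨a, b⟩
    rw [hn] at h1 h2
    simp only at h1 h2
    rw [cos_sub]
    linear_combination (-cos x) * h1 - sin x * h2
  rcases hd with rfl | rfl
  · obtain ⟨θ, h⟩ := polar (ξ.2 0) 0 ‖ξ.2‖ (by simp [EuclideanSpace.norm_eq])
    exact ⟨θ, fun x => by rw [← h]; simp [fibrePotential]⟩
  · obtain ⟨θ, h⟩ := polar (ξ.2 0) (ξ.2 1) ‖ξ.2‖
      (by simp [EuclideanSpace.norm_eq, Fin.sum_univ_two])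
    exact ⟨θ, fun x => by rw [← h]; simp [fibrePotential, Fin.sum_univ_two]⟩

theorem cos_mul_circleMode (n : ℤ) (θ : ℝ) (m : ℤ) (x : ℝ) :
    ((cos (x - θ) : ℝ) : ℂ) * circleMode n θ m x
      = (circleMode n θ (m - 1) x + circleMode n θ (m + 1) x) / 2 := by
  have e1 : circleMode n θ (m - 1) x
      = Complex.exp (((x - θ : ℝ) : ℂ) * Complex.I) * circleMode n θ m x := by
    rw [circleMode, circleMode, ← Complex.exp_add]; push_cast; ring_nf
  have e2 : circleMode n θ (m + 1) x
      = Complex.exp (-((x - θ : ℝ) : ℂ) * Complex.I) * circleMode n θ m x := by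
    rw [circleMode, circleMode, ← Complex.exp_add]; push_cast; ring_nf
  rw [e1, e2, Complex.ofReal_cos, Complex.cos]
  ring

/-- The eigenvalue equation becomes the three-term recurrence. -/
theorem IsFibreEigenfunction.recurrence {d : ℕ} {ξ : WaveNumber d} {θ : ℝ}
    (hθ : ∀ x, fibrePotential ξ x = ‖ξ.2‖ * cos (x - θ)) {μ : ℝ} {f : ℝ → ℂ}
    (hf : IsFibreEigenfunction ξ μ f) (n m : ℤ) :
    ((((m : ℝ) + (ξ.1 - n)) ^ 2 + ‖ξ.2‖ ^ 2 - μ : ℝ) : ℂ) *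
        (∫ x, f x * circleMode n θ m x ∂periodMeasure)
      = (‖ξ.2‖ / 2 : ℝ) * ((∫ x, f x * circleMode n θ (m - 1) x ∂periodMeasure)
          + ∫ x, f x * circleMode n θ (m + 1) x ∂periodMeasure) := by
  obtain ⟨⟨hL, f₁, f₂, hL₁, hL₂, hw₁, hw₂, hg⟩, -⟩ := hf
  have i0 := hL.integrable_mul_circleMode n θ
  have i1 := hL₁.integrable_mul_circleMode n θ m
  have i2 := hL₂.integrable_mul_circleMode n θ m
  have e1 := hw₁.integral_mul_circleMode n θ m
  have e2 := hw₂.integral_mul_circleMode n θ m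
  have hae : (fun x => (μ : ℂ) * (f x * circleMode n θ m x)) =ᵐ[periodMeasure] fun x =>
      (-1 : ℂ) * (f₂ x * circleMode n θ m x)
        + (-2 * Complex.I * ξ.1) * (f₁ x * circleMode n θ m x)
        + ((ξ.1 ^ 2 + ‖ξ.2‖ ^ 2 : ℝ) : ℂ) * (f x * circleMode n θ m x)
        + (-(‖ξ.2‖ / 2 : ℝ) : ℂ) * (f x * circleMode n θ (m - 1) x)
        + (-(‖ξ.2‖ / 2 : ℝ) : ℂ) * (f x * circleMode n θ (m + 1) x) := by
    filter_upwards [hg] with x hx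
    have hc := cos_mul_circleMode n θ m x
    rw [hθ] at hx
    push_cast at hx hc ⊢
    linear_combination circleMode n θ m x * hx - (‖ξ.2‖ : ℂ) * f x * hc
  have hI := integral_congr_ae hae
  have j2 := (i2.const_mul (-1)).add (i1.const_mul (-2 * Complex.I * ξ.1))
  have j3 := j2.add ((i0 m).const_mul ((ξ.1 ^ 2 + ‖ξ.2‖ ^ 2 : ℝ) : ℂ))
  have j4 := j3.add ((i0 (m - 1)).const_mul (-(‖ξ.2‖ / 2 : ℝ) : ℂ))
  rw [integral_add (by exact j4) ((i0 (m + 1)).const_mul _),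
    integral_add (by exact j3) ((i0 (m - 1)).const_mul _),
    integral_add (by exact j2) ((i0 m).const_mul _),
    integral_add (i2.const_mul _) (i1.const_mul _)] at hI
  simp only [integral_const_mul] at hI
  rw [e2, e1] at hI
  push_cast at hI ⊢
  linear_combination -hI + (((n : ℂ) - m) ^ 2 - 2 * ξ.1 * (n - m))
    * (∫ x, f x * circleMode n θ m x ∂periodMeasure) * Complex.I_sq

/-- Rapidly decaying solutions of the recurrence give elements of the domain satisfying the
eigenvalue equation. -/
theorem isFibreOp_of_recurrence {d : ℕ} {ξ : WaveNumber d} {θ : ℝ}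
    (hθ : ∀ x, fibrePotential ξ x = ‖ξ.2‖ * cos (x - θ)) {μ : ℝ} (n : ℤ) {a : ℤ → ℂ}
    (hdec : RapidDecay a)
    (ha : ∀ m : ℤ, ((((m : ℝ) + (ξ.1 - n)) ^ 2 + ‖ξ.2‖ ^ 2 - μ : ℝ) : ℂ) * a m
      = (‖ξ.2‖ / 2 : ℝ) * (a (m - 1) + a (m + 1))) {f : ℝ → ℂ}
    (hf : ∀ x : ℝ, f x = Complex.exp (-(Complex.I * n * x)) * trigSeries a (x - θ)) :
    IsFibreOp ξ f fun x => (μ : ℂ) * f x := by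
  obtain rfl : f = fun x : ℝ => Complex.exp (-(Complex.I * n * x)) * trigSeries a (x - θ) :=
    funext hf
  clear hf
  set E : ℝ → ℂ := fun x => Complex.exp (-(Complex.I * n * x)) with hE
  set a₁ : ℤ → ℂ := fun m => Complex.I * m * a m with ha₁
  set a₂ : ℤ → ℂ := fun m => Complex.I * m * a₁ m with ha₂
  have hdec₁ : RapidDecay a₁ := by simpa using hdec.pow_mul 1
  have hdec₂ : RapidDecay a₂ := by simpa using hdec₁.pow_mul 1
  have hE' : ∀ x, HasDerivAt E (-(Complex.I * n) * E x) x := by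
    intro x
    have h0 : HasDerivAt (fun y : ℝ => (y : ℂ)) 1 x := (hasDerivAt_id x).ofReal_comp
    have h1 : HasDerivAt (fun y : ℝ => -(Complex.I * n * y)) (-(Complex.I * n * 1)) x :=
      (h0.const_mul (Complex.I * n)).neg
    exact h1.cexp.congr_deriv (by rw [hE]; ring)
  have hEper : Function.Periodic E (2 * π) := by
    intro x
    rw [hE]
    simp only
    rw [Complex.exp_eq_exp_iff_exists_int]
    exact ⟨-n, by push_cast; ring⟩
  have hu : ∀ {b : ℤ → ℂ}, RapidDecay b → ∀ x,
      HasDerivAt (fun x => trigSeries b (x - θ))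
        (trigSeries (fun m => Complex.I * m * b m) (x - θ)) x := fun hb x =>
    (hb.hasDerivAt (x - θ)).comp_sub_const x θ
  have hcont : ∀ {b : ℤ → ℂ}, RapidDecay b → Continuous fun x => trigSeries b (x - θ) := fun hb =>
    hb.contDiff.continuous.comp (continuous_id.sub continuous_const)
  have hper : ∀ b : ℤ → ℂ, Function.Periodic (fun x => trigSeries b (x - θ)) (2 * π) :=
    fun b => (trigSeries_periodic b).sub_const θ
  have hEc : Continuous E := continuous_iff_continuousAt.2 fun x => (hE' x).continuousAt
  set u : ℝ → ℂ := fun x => trigSeries a (x - θ) with hudef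
  set u₁ : ℝ → ℂ := fun x => trigSeries a₁ (x - θ) with hu₁def
  set u₂ : ℝ → ℂ := fun x => trigSeries a₂ (x - θ) with hu₂def
  have hu₀' : ∀ x, HasDerivAt u (u₁ x) x := hu hdec
  have hu₁' : ∀ x, HasDerivAt u₁ (u₂ x) x := hu hdec₁
  have hu₀c : Continuous u := hcont hdec
  have hu₁c : Continuous u₁ := hcont hdec₁
  have hu₂c : Continuous u₂ := hcont hdec₂
  have hu₀p : Function.Periodic u (2 * π) := hper a
  have hu₁p : Function.Periodic u₁ (2 * π) := hper a₁
  have hu₂p : Function.Periodic u₂ (2 * π) := hper a₂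
  have hd1 : ∀ x, HasDerivAt (fun x => E x * u x) (E x * (u₁ x - Complex.I * n * u x)) x :=
    fun x => ((hE' x).mul (hu₀' x)).congr_deriv (by ring)
  have hd2 : ∀ x, HasDerivAt (fun x => E x * (u₁ x - Complex.I * n * u x))
      (E x * (u₂ x - 2 * Complex.I * n * u₁ x - (n : ℂ) ^ 2 * u x)) x := fun x => by
    have h1 : HasDerivAt (fun x => u₁ x - Complex.I * n * u x) (u₂ x - Complex.I * n * u₁ x) x :=
      (hu₁' x).sub ((hu₀' x).const_mul (Complex.I * n))
    exact ((hE' x).mul h1).congr_deriv (by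
      linear_combination E x * (n : ℂ) ^ 2 * u x * Complex.I_sq)
  have hp1 : Function.Periodic (fun x => E x * (u₁ x - Complex.I * n * u x)) (2 * π) := fun x => by
    simp only [hEper x, hu₁p x, hu₀p x]
  refine ⟨memL2Circle_of_continuous (hEc.mul hu₀c) (hEper.mul hu₀p),
    fun x => E x * (u₁ x - Complex.I * n * u x),
    fun x => E x * (u₂ x - 2 * Complex.I * n * u₁ x - (n : ℂ) ^ 2 * u x),
    memL2Circle_of_continuous (by fun_prop) hp1,
    memL2Circle_of_continuous (by fun_prop)
      (fun x => by simp only [hEper x, hu₁p x, hu₀p x, hu₂p x]),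
    isWeakDerivCircle_of_hasDerivAt hd1 (by fun_prop) (hEper.mul hu₀p),
    isWeakDerivCircle_of_hasDerivAt hd2 (by fun_prop) hp1, ae_of_all _ fun x => ?_⟩
  have hode : -u₂ x - 2 * Complex.I * (ξ.1 - n) * u₁ x
      + ((ξ.1 - n) ^ 2 + (‖ξ.2‖ : ℂ) ^ 2 - μ) * u x
      - (‖ξ.2‖ / 2 : ℂ) * (((2 * cos (x - θ) : ℝ) : ℂ) * u x) = 0 := by
    have h := ((((hdec₂.hasSum (x - θ)).neg).sub
      ((hdec₁.hasSum (x - θ)).mul_left (2 * Complex.I * (ξ.1 - n)))).add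
      ((hdec.hasSum (x - θ)).mul_left ((ξ.1 - n) ^ 2 + (‖ξ.2‖ : ℂ) ^ 2 - μ))).sub
      ((hdec.hasSum_two_cos_mul (x - θ)).mul_left (‖ξ.2‖ / 2 : ℂ))
    refine (h.unique ?_)
    refine (congrArg (HasSum · (0 : ℂ)) (funext fun m => ?_)).mpr hasSum_zero
    have hm := ha m
    push_cast at hm
    simp only [ha₂, ha₁]
    linear_combination Complex.exp (Complex.I * (m * ((x - θ : ℝ) : ℂ))) * hm
      + Complex.exp (Complex.I * (m * ((x - θ : ℝ) : ℂ))) * a m *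
        (-(m : ℂ) ^ 2 - 2 * (ξ.1 - n) * m) * Complex.I_sq
  change (μ : ℂ) * (E x * u x) = -(E x * (u₂ x - 2 * Complex.I * n * u₁ x - (n : ℂ) ^ 2 * u x))
    - 2 * Complex.I * ξ.1 * (E x * (u₁ x - Complex.I * n * u x))
    + ((ξ.1 ^ 2 + ‖ξ.2‖ ^ 2 : ℝ) : ℂ) * (E x * u x) - (fibrePotential ξ x : ℂ) * (E x * u x)
  rw [hθ]
  push_cast at hode ⊢
  linear_combination -(E x) * hode - 2 * ξ.1 * n * E x * u x * Complex.I_sq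

/-! ### The expansion of the ground state -/

/-- The coefficients of `1 + p * cos x`. -/
noncomputable def firstOrder (p : ℝ) (m : ℤ) : ℝ :=
  if m = 0 then 1 else if m.natAbs = 1 then p / 2 else 0

theorem hasSum_firstOrder (p x : ℝ) :
    HasSum (fun m : ℤ => (firstOrder p m : ℂ) * Complex.exp (Complex.I * (m * x)))
      ((1 + p * cos x : ℝ) : ℂ) := by
  have h := hasSum_sum_of_ne_finset_zero (L := .unconditional ℤ) (s := ({0, 1, -1} : Finset ℤ))
    (f := fun m : ℤ => (firstOrder p m : ℂ) * Complex.exp (Complex.I * (m * x))) (by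
      intro m hm
      simp only [Finset.mem_insert, Finset.mem_singleton, not_or] at hm
      rw [firstOrder, if_neg hm.1, if_neg (by omega)]
      simp)
  convert h using 1
  rw [Finset.sum_insert (by decide), Finset.sum_insert (by decide), Finset.sum_singleton]
  simp only [firstOrder]
  norm_num [Complex.cos]
  ring_nf

theorem abs_sub_firstOrder_le {p ρ : ℝ} (hp0 : 0 ≤ p) (hp : p ≤ ρ) (hρ : ρ ≤ 1 / 100) {c : ℤ → ℝ}
    (hc0 : c 0 = 1) (hc : ∀ m, |c m| ≤ (2 * p) ^ m.natAbs) (h1 : |c 1 - p / 2| ≤ 3 * p * ρ)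
    (h2 : |c (-1) - p / 2| ≤ 3 * p * ρ) (m : ℤ) :
    |c m - firstOrder p m| ≤ 16 * ρ ^ 2 * (1 / 2) ^ m.natAbs := by
  have hpρ : p * ρ ≤ ρ ^ 2 := by nlinarith
  rw [firstOrder]
  split_ifs with h h'
  · subst h
    simpa [hc0] using by positivity
  · rw [h']
    rcases Int.natAbs_eq m with e | e <;> rw [h'] at e <;> subst e <;> norm_num at h1 h2 ⊢ <;>
      nlinarith
  · obtain ⟨j, hj⟩ : ∃ j, m.natAbs = j + 2 := ⟨m.natAbs - 2, by omega⟩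
    rw [sub_zero]
    refine (hc m).trans ?_
    rw [hj, pow_add, pow_add]
    have e1 : (2 * p) ^ j ≤ (1 / 2) ^ j := pow_le_pow_left₀ (by positivity) (by linarith) j
    have e2 : (2 * p) ^ 2 ≤ 4 * ρ ^ 2 := by nlinarith
    calc (2 * p) ^ j * (2 * p) ^ 2 ≤ (1 / 2) ^ j * (4 * ρ ^ 2) := by gcongr
      _ = _ := by ring

theorem norm_trigSeries_sub_le {p ρ : ℝ} {c : ℤ → ℝ}
    (h : ∀ m, |c m - firstOrder p m| ≤ 16 * ρ ^ 2 * (1 / 2) ^ m.natAbs)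
    (hdec : RapidDecay fun m => (c m : ℂ)) (x : ℝ) :
    ‖trigSeries (fun m => (c m : ℂ)) x - ((1 + p * cos x : ℝ) : ℂ)‖ ≤ 48 * ρ ^ 2 := by
  have hs := (hdec.hasSum x).sub (hasSum_firstOrder p x)
  rw [← hs.tsum_eq]
  refine (tsum_of_norm_bounded (hasSum_half_pow_natAbs.mul_left (16 * ρ ^ 2)) fun m => ?_).trans
    (le_of_eq (by ring))
  rw [← sub_mul, norm_mul, norm_exp_I_mul_int_mul, mul_one, ← Complex.ofReal_sub, Complex.norm_real]
  exact h m

theorem integral_cos_sub (θ : ℝ) : ∫ x, cos (x - θ) ∂periodMeasure = 0 := by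
  rw [integral_periodMeasure, intervalIntegral.integral_comp_sub_right cos, integral_cos,
    sub_eq_zero, Real.sin_eq_sin_iff]
  exact ⟨-1, Or.inl (by push_cast; ring)⟩

theorem measureReal_periodMeasure_univ : periodMeasure.real Set.univ = 2 * π := by
  simp [periodMeasure, Measure.real, Real.pi_pos.le]

/-- The normalization constant is `1` up to second order, since the first-order term `p * cos`
has mean value zero. -/
theorem abs_mean_norm_sq_sub_one_le {p ρ θ : ℝ} (hp0 : 0 ≤ p) (hp : p ≤ ρ) (hρ : ρ ≤ 1 / 100)
    {u : ℝ → ℂ} (hu : Continuous u) (h : ∀ x, ‖u x - ((1 + p * cos x : ℝ) : ℂ)‖ ≤ 48 * ρ ^ 2) :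
    |(2 * π)⁻¹ * ∫ x, ‖u (x - θ)‖ ^ 2 ∂periodMeasure - 1| ≤ 102 * ρ ^ 2 := by
  have hpt : ∀ x, |‖u x‖ ^ 2 - 1 - 2 * p * cos x| ≤ 102 * ρ ^ 2 := by
    intro x
    have hcos := Real.neg_one_le_cos x
    have hcos' := Real.cos_le_one x
    have hv : 0 ≤ 1 + p * cos x := by nlinarith
    have hv' : 1 + p * cos x ≤ 1 + p := by nlinarith
    have h1 : |‖u x‖ - (1 + p * cos x)| ≤ 48 * ρ ^ 2 := by
      have := (abs_norm_sub_norm_le (u x) ((1 + p * cos x : ℝ) : ℂ)).trans (h x)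
      rwa [Complex.norm_of_nonneg hv] at this
    have h2 := (abs_le.1 h1).2
    have e : ‖u x‖ ^ 2 - 1 - 2 * p * cos x
        = (‖u x‖ - (1 + p * cos x)) * (‖u x‖ + (1 + p * cos x)) + p ^ 2 * cos x ^ 2 := by ring
    have hρ2 : ρ ^ 2 ≤ (1 / 100) ^ 2 := pow_le_pow_left₀ (hp0.trans hp) hρ 2
    have h3 : |(‖u x‖ - (1 + p * cos x)) * (‖u x‖ + (1 + p * cos x))|
        ≤ 48 * ρ ^ 2 * (2 + 1 / 10) := by
      rw [abs_mul]
      refine mul_le_mul h1 ?_ (abs_nonneg _) (by positivity)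
      rw [abs_of_nonneg (by positivity)]
      linarith
    have h4 : |p ^ 2 * cos x ^ 2| ≤ ρ ^ 2 := by
      rw [abs_of_nonneg (by positivity)]
      calc p ^ 2 * cos x ^ 2 ≤ ρ ^ 2 * 1 := by
            gcongr
            exact Real.cos_sq_le_one x
        _ = _ := mul_one _
    rw [e]
    refine (abs_add_le _ _).trans ((add_le_add h3 h4).trans ?_)
    nlinarith [sq_nonneg ρ]
  have hcu : Continuous fun x => ‖u (x - θ)‖ ^ 2 := by fun_prop
  have hcc : Continuous fun x => 2 * p * cos (x - θ) := by fun_prop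
  have e : ∫ x, (‖u (x - θ)‖ ^ 2 - 1 - 2 * p * cos (x - θ)) ∂periodMeasure
      = (∫ x, ‖u (x - θ)‖ ^ 2 ∂periodMeasure) - 2 * π := by
    rw [integral_sub (by exact (integrable_periodMeasure hcu).sub (integrable_const 1))
      (integrable_periodMeasure hcc), integral_sub (integrable_periodMeasure hcu)
      (integrable_const 1), integral_const_mul, integral_cos_sub, integral_const,
      measureReal_periodMeasure_univ]
    simp
  have hb := norm_integral_le_of_norm_le_const (μ := periodMeasure)
    (f := fun x => ‖u (x - θ)‖ ^ 2 - 1 - 2 * p * cos (x - θ)) (C := 102 * ρ ^ 2)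
    (ae_of_all _ fun x => hpt (x - θ))
  rw [e, measureReal_periodMeasure_univ, Real.norm_eq_abs] at hb
  have hpi := Real.two_pi_pos
  have e2 : (2 * π)⁻¹ * ∫ x, ‖u (x - θ)‖ ^ 2 ∂periodMeasure - 1
      = (2 * π)⁻¹ * ((∫ x, ‖u (x - θ)‖ ^ 2 ∂periodMeasure) - 2 * π) := by
    field_simp
  rw [e2, abs_mul, abs_of_pos (inv_pos.2 hpi), inv_mul_le_iff₀ hpi]
  linarith

theorem abs_inv_sqrt_sub_one_le {t ε : ℝ} (h : |t - 1| ≤ ε) (hε : ε ≤ 1 / 2) :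
    |(√t)⁻¹ - 1| ≤ 2 * ε := by
  have ht : 1 / 2 ≤ t := by linarith [(abs_le.1 h).1]
  have hs : 1 / 2 ≤ √t := Real.le_sqrt_of_sq_le (by linarith)
  have hsq := Real.sq_sqrt (by linarith : 0 ≤ t)
  have hpos : 0 < √t := by linarith
  have e : (√t)⁻¹ - 1 = (1 - t) / (√t * (1 + √t)) := by
    rw [eq_div_iff (by positivity)]
    field_simp
    linear_combination -hsq
  have hε0 : 0 ≤ ε := (abs_nonneg _).trans h
  rw [e, abs_div, abs_of_pos (by positivity : 0 < √t * (1 + √t)), abs_sub_comm,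
    div_le_iff₀ (by positivity)]
  nlinarith

theorem abs_inv_mul_sub_firstOrder_le {p ρ N : ℝ} {c : ℤ → ℝ} (hp0 : 0 ≤ p) (hp : p ≤ 1 / 100)
    (hc : ∀ m, |c m| ≤ (2 * p) ^ m.natAbs)
    (h : ∀ m, |c m - firstOrder p m| ≤ 16 * ρ ^ 2 * (1 / 2) ^ m.natAbs)
    (hN : |N⁻¹ - 1| ≤ 2 * (102 * ρ ^ 2)) (m : ℤ) :
    |N⁻¹ * c m - firstOrder p m| ≤ 220 * ρ ^ 2 * (1 / 2) ^ m.natAbs := by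
  have e : N⁻¹ * c m - firstOrder p m = (N⁻¹ - 1) * c m + (c m - firstOrder p m) := by ring
  have h1 : |(N⁻¹ - 1) * c m| ≤ 2 * (102 * ρ ^ 2) * (1 / 2) ^ m.natAbs := by
    rw [abs_mul]
    refine mul_le_mul hN ((hc m).trans ?_) (abs_nonneg _) (by positivity)
    exact pow_le_pow_left₀ (by positivity) (by linarith) _
  rw [e]
  refine (abs_add_le _ _).trans ((add_le_add h1 (h m)).trans (le_of_eq (by ring)))

/-- The bound for the `k`-th derivative of the remainder, per unit of `|ξ|_*²`. -/
noncomputable def remainderConst (k : ℕ) : ℝ :=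
  220 * ∑' m : ℤ, (m.natAbs : ℝ) ^ k * (1 / 2 : ℝ) ^ m.natAbs + 1

theorem remainderConst_pos (k : ℕ) : 0 < remainderConst k := by
  have : 0 ≤ ∑' m : ℤ, (m.natAbs : ℝ) ^ k * (1 / 2 : ℝ) ^ m.natAbs :=
    tsum_nonneg fun m => by positivity
  rw [remainderConst]
  positivity

theorem inv_sqrt_two_pi_le_one : (√(2 * π))⁻¹ ≤ 1 :=
  inv_le_one_of_one_le₀ (Real.one_le_sqrt.2 (by linarith [Real.pi_gt_three]))

theorem distInt_le_starNorm {d : ℕ} (ξ : WaveNumber d) : distInt ξ.1 ≤ starNorm ξ :=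
  Real.le_sqrt_of_sq_le (le_add_of_nonneg_right (sq_nonneg _))

theorem norm_le_starNorm {d : ℕ} (ξ : WaveNumber d) : ‖ξ.2‖ ≤ starNorm ξ :=
  Real.le_sqrt_of_sq_le (le_add_of_nonneg_left (sq_nonneg _))

/-- All the assertions at one wave number near the zero set of `|·|_*`. -/
theorem exists_ground_state {d : ℕ} (hd : d = 2 ∨ d = 3) (ξ : WaveNumber d)
    (hξ : starNorm ξ < 1 / 100) :
    |lowestEigenvalue ξ - (distInt ξ.1 ^ 2 + 1 / 2 * ‖ξ.2‖ ^ 2)| ≤ 3 * starNorm ξ ^ 3 ∧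
    ∃ φ R : ℝ → ℂ,
      IsLeast (fibreEigenvalues ξ) (lowestEigenvalue ξ) ∧
      IsFibreEigenfunction ξ (lowestEigenvalue ξ) φ ∧
      ∫ x, ‖φ x‖ ^ 2 ∂periodMeasure = 1 ∧
      (∀ f, IsFibreEigenfunction ξ (lowestEigenvalue ξ) f →
        ∃ c : ℂ, f =ᵐ[periodMeasure] fun x => c * φ x) ∧
      (∀ x : ℝ, Complex.exp (Complex.I * (round ξ.1 : ℂ) * (x : ℂ)) * φ x =
        (((√(2 * π))⁻¹ * (1 + fibrePotential ξ x) : ℝ) : ℂ) + R x) ∧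
      Function.Periodic R (2 * π) ∧ ContDiff ℝ ∞ R ∧
      ∀ (k : ℕ) (x : ℝ), ‖iteratedDeriv k R x‖ ≤ remainderConst k * starNorm ξ ^ 2 := by
  obtain ⟨θ, hθ⟩ := exists_phase hd ξ
  set n : ℤ := round ξ.1 with hn
  set s : ℝ := ξ.1 - n with hsdef
  set p : ℝ := ‖ξ.2‖ with hpdef
  set ρ : ℝ := starNorm ξ with hρdef
  have hs : |s| ≤ ρ := distInt_le_starNorm ξ
  have hp0 : 0 ≤ p := norm_nonneg _
  have hp : p ≤ ρ := norm_le_starNorm ξ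
  have hρ : ρ ≤ 1 / 100 := hξ.le
  have hρ0 : 0 ≤ ρ := hp0.trans hp
  obtain ⟨c, μ, hc0, hc, h1, h2, hrec, hμ, hμ4⟩ := exists_ground_sequence hs hp0 hp hρ
  have hs' := hs.trans hρ
  have hp' := hp.trans hρ
  have hrecC : ∀ κ : ℂ, ∀ m : ℤ, ((((m : ℝ) + s) ^ 2 + p ^ 2 - μ : ℝ) : ℂ) * (κ * c m)
      = (p / 2 : ℝ) * (κ * c (m - 1) + κ * c (m + 1)) := by
    intro κ m
    have h := congrArg (fun t : ℝ => (t : ℂ)) (hrec m)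
    push_cast at h ⊢
    linear_combination κ * h
  have hdec : ∀ κ : ℂ, RapidDecay fun m => κ * (c m : ℂ) := fun κ =>
    RapidDecay.of_le (K := ‖κ‖) fun m => by
      rw [norm_mul, Complex.norm_real, Real.norm_eq_abs]
      gcongr
      exact (hc m).trans (pow_le_pow_left₀ (by positivity) (by linarith) _)
  have hdec1 : RapidDecay fun m => (c m : ℂ) := by simpa using hdec 1
  have hmul : ∀ (κ : ℂ) (x : ℝ), trigSeries (fun m => κ * (c m : ℂ)) x
      = κ * trigSeries (fun m => (c m : ℂ)) x := fun κ x => by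
    rw [trigSeries, trigSeries, ← tsum_mul_left]
    simp only [mul_assoc]
  have hfirst := abs_sub_firstOrder_le hp0 hp hρ hc0 hc h1 h2
  set u : ℝ → ℂ := trigSeries fun m => (c m : ℂ) with hu
  have hmean := abs_mean_norm_sq_sub_one_le (θ := θ) hp0 hp hρ hdec1.contDiff.continuous
    (norm_trigSeries_sub_le hfirst hdec1)
  rw [← hu] at hmean
  set t : ℝ := (2 * π)⁻¹ * ∫ x, ‖u (x - θ)‖ ^ 2 ∂periodMeasure with ht
  have hε : 102 * ρ ^ 2 ≤ 1 / 2 := by nlinarith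
  have hN := abs_inv_sqrt_sub_one_le hmean hε
  have htpos : 0 < t := by linarith [(abs_le.1 hmean).1]
  set κ : ℝ := (√(2 * π))⁻¹ * (√t)⁻¹ with hκ
  set φ : ℝ → ℂ := fun x => Complex.exp (-(Complex.I * n * x)) *
    trigSeries (fun m => (κ : ℂ) * (c m : ℂ)) (x - θ) with hφ
  set r : ℤ → ℂ := fun m =>
    ((√(2 * π))⁻¹ : ℝ) * (((√t)⁻¹ * c m - firstOrder p m : ℝ) : ℂ) with hr
  have hrb : ∀ m, ‖r m‖ ≤ 220 * ρ ^ 2 * (1 / 2) ^ m.natAbs := by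
    intro m
    rw [hr]
    simp only
    rw [norm_mul, Complex.norm_real, Complex.norm_real, Real.norm_eq_abs, Real.norm_eq_abs,
      abs_of_nonneg (by positivity)]
    refine (mul_le_of_le_one_left (abs_nonneg _) inv_sqrt_two_pi_le_one).trans ?_
    exact abs_inv_mul_sub_firstOrder_le hp0 hp' hc hfirst hN m
  have hrdec : RapidDecay r := RapidDecay.of_le hrb
  -- `φ` is an eigenfunction, normalized by the choice of `t`.
  have hφop : IsFibreOp ξ φ fun x => (μ : ℂ) * φ x :=
    isFibreOp_of_recurrence hθ n (hdec κ) (hrecC κ) fun x => rfl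
  have hφnorm : ∫ x, ‖φ x‖ ^ 2 ∂periodMeasure = 1 := by
    have e : ∀ x, ‖φ x‖ ^ 2 = κ ^ 2 * ‖u (x - θ)‖ ^ 2 := by
      intro x
      have hE : ‖Complex.exp (-(Complex.I * n * x))‖ = 1 := by
        have := norm_exp_I_mul_int_mul (-n) x
        push_cast at this
        rwa [neg_mul, mul_neg, ← mul_assoc] at this
      rw [hφ]
      simp only
      rw [hmul, norm_mul, hE, one_mul, norm_mul, Complex.norm_real, mul_pow, Real.norm_eq_abs,
        sq_abs]
    simp only [e, integral_const_mul]
    have hI : ∫ x, ‖u (x - θ)‖ ^ 2 ∂periodMeasure = 2 * π * t := by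
      rw [ht, mul_inv_cancel_left₀ Real.two_pi_pos.ne']
    have hpi := Real.two_pi_pos
    rw [hI, hκ, mul_pow, inv_pow, inv_pow, Real.sq_sqrt hpi.le, Real.sq_sqrt htpos.le]
    field_simp
  have hφeig : IsFibreEigenfunction ξ μ φ := by
    refine ⟨hφop, fun h0 => ?_⟩
    have : ∫ x, ‖φ x‖ ^ 2 ∂periodMeasure = 0 := by
      rw [integral_congr_ae (g := fun _ => (0 : ℝ)) (h0.mono fun x hx => by simp [hx])]
      simp
    exact one_ne_zero (hφnorm.symm.trans this)
  have hbdd : ∀ (f : ℝ → ℂ) (m : ℤ), ‖∫ x, f x * circleMode n θ m x ∂periodMeasure‖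
      ≤ ∫ x, ‖f x‖ ∂periodMeasure := fun f m => norm_integral_mul_circleMode_le n θ m
  have hne : ∀ {ν : ℝ} {f : ℝ → ℂ}, IsFibreEigenfunction ξ ν f →
      ∃ m, ∫ x, f x * circleMode n θ m x ∂periodMeasure ≠ 0 := fun hf => by
    by_contra! h
    exact hf.2 (hf.1.1.ae_eq_zero n θ h)
  have hleast : IsLeast (fibreEigenvalues ξ) μ := by
    refine ⟨⟨φ, hφeig⟩, ?_⟩
    rintro ν ⟨f, hf⟩
    exact le_of_bounded_recurrence hs' hp0 hp' hμ4 hc0 hc hrec (hbdd f)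
      (hf.recurrence hθ n) (hne hf)
  have hlow : lowestEigenvalue ξ = μ := hleast.csInf_eq
  rw [hlow]
  refine ⟨?_, φ, fun x => trigSeries r (x - θ), hleast, hφeig, hφnorm, fun f hf => ?_,
    fun x => ?_, (trigSeries_periodic r).sub_const θ,
    hrdec.contDiff.comp (contDiff_id.sub contDiff_const), fun k x => ?_⟩
  · rw [distInt, sq_abs]
    exact hμ
  · -- Both coefficient sequences are multiples of the same solution of the recurrence.
    have key : ∀ {g : ℝ → ℂ}, IsFibreEigenfunction ξ μ g → ∀ m,
        ∫ x, g x * circleMode n θ m x ∂periodMeasure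
          = (∫ x, g x * circleMode n θ 0 x ∂periodMeasure) * c m := fun hg =>
      eq_mul_of_ground_recurrence hs' hp0 hp' hμ4 hc0 hc hrec (hbdd _) (hg.recurrence hθ n)
    set a := ∫ x, f x * circleMode n θ 0 x ∂periodMeasure with ha
    set b := ∫ x, φ x * circleMode n θ 0 x ∂periodMeasure with hb
    have hb0 : b ≠ 0 := by
      obtain ⟨m, hm⟩ := hne hφeig
      rw [key hφeig m] at hm
      exact left_ne_zero_of_mul hm
    refine ⟨a / b, ?_⟩
    have hL : MemL2Circle fun x => f x - a / b * φ x :=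
      ⟨fun x => by simp only [hf.1.1.1 x, hφop.1.1 x], hf.1.1.2.sub (hφop.1.2.const_mul _)⟩
    have hz := hL.ae_eq_zero n θ fun m => by
      simp only [sub_mul, mul_assoc]
      rw [integral_sub (hf.1.1.integrable_mul_circleMode n θ m)
        ((hφop.1.integrable_mul_circleMode n θ m).const_mul _), integral_const_mul, key hf m,
        key hφeig m, ← ha, ← hb]
      field_simp
      ring
    filter_upwards [hz] with x hx
    exact sub_eq_zero.1 hx
  · have hsum := ((hdec κ).hasSum (x - θ)).sub
      ((hasSum_firstOrder p (x - θ)).mul_left (((√(2 * π))⁻¹ : ℝ) : ℂ))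
    have hR := (hrdec.hasSum (x - θ)).unique ((congrArg (HasSum · _) (funext fun m => by
      rw [hr, hκ]
      push_cast
      ring)).mpr hsum)
    have hE : Complex.exp (Complex.I * n * x) * Complex.exp (-(Complex.I * n * x)) = 1 := by
      rw [← Complex.exp_add, add_neg_cancel, Complex.exp_zero]
    simp only [hR, hφ, hθ]
    rw [← mul_assoc, hE]
    push_cast
    ring
  · rw [iteratedDeriv_comp_sub_const]
    refine (norm_iteratedDeriv_trigSeries_le hrb k (x - θ)).trans ?_
    rw [remainderConst]
    nlinarith [sq_nonneg ρ]

theorem lowestEigenvalue_isLittleO {d : ℕ} (hd : d = 2 ∨ d = 3) :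
    (fun ξ : WaveNumber d => lowestEigenvalue ξ - (distInt ξ.1 ^ 2 + 1 / 2 * ‖ξ.2‖ ^ 2))
      =o[comap starNorm (𝓝 0)] fun ξ : WaveNumber d => starNorm ξ ^ 2 := by
  refine isLittleO_iff.2 fun ε hε => ?_
  have hmem : Set.Iio (min (1 / 100) (ε / 3)) ∈ 𝓝 (0 : ℝ) :=
    Iio_mem_nhds (lt_min (by norm_num) (by positivity))
  filter_upwards [preimage_mem_comap hmem] with ξ hξ
  have h1 : starNorm ξ < 1 / 100 := lt_of_lt_of_le hξ (min_le_left _ _)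
  have h2 : starNorm ξ < ε / 3 := lt_of_lt_of_le hξ (min_le_right _ _)
  rw [Real.norm_eq_abs, Real.norm_eq_abs, abs_of_nonneg (sq_nonneg (starNorm ξ))]
  refine (exists_ground_state hd ξ h1).1.trans ?_
  nlinarith [sq_nonneg (starNorm ξ)]

theorem proposition3 (d : ℕ) (hd : d = 2 ∨ d = 3) :
    -- the expansion of the lowest eigenvalue, as `|ξ|_* → 0`
    ((fun ξ : WaveNumber d =>
        lowestEigenvalue ξ - (distInt ξ.1 ^ 2 + 1 / 2 * ‖ξ.2‖ ^ 2))
      =o[comap starNorm (𝓝 0)] fun ξ : WaveNumber d => starNorm ξ ^ 2) ∧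
    ∃ δ₀ : ℝ, 0 < δ₀ ∧ ∃ C : ℕ → ℝ, (∀ k, 0 < C k) ∧
      ∃ φ₀ R₀ : WaveNumber d → ℝ → ℂ, ∀ ξ : WaveNumber d, starNorm ξ < δ₀ →
        -- `λ₀(ξ)` is attained: it is the least eigenvalue of `A_ξ`
        IsLeast (fibreEigenvalues ξ) (lowestEigenvalue ξ) ∧
        -- `φ₀(ξ, ·)` is the normalized eigenfunction, unique up to a constant factor
        IsFibreEigenfunction ξ (lowestEigenvalue ξ) (φ₀ ξ) ∧
        ∫ x, ‖φ₀ ξ x‖ ^ 2 ∂periodMeasure = 1 ∧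
        (∀ f, IsFibreEigenfunction ξ (lowestEigenvalue ξ) f →
          ∃ c : ℂ, f =ᵐ[periodMeasure] fun x => c * φ₀ ξ x) ∧
        -- its expansion; the exponential is `1` when `|ξ₁| < 1/2`
        (∀ x : ℝ, Complex.exp (Complex.I * (round ξ.1 : ℂ) * (x : ℂ)) * φ₀ ξ x =
          (((√(2 * π))⁻¹ * (1 + fibrePotential ξ x) : ℝ) : ℂ) + R₀ ξ x) ∧
        -- the remainder
        Function.Periodic (R₀ ξ) (2 * π) ∧ ContDiff ℝ ∞ (R₀ ξ) ∧
        ∀ (k : ℕ) (x : ℝ), ‖iteratedDeriv k (R₀ ξ) x‖ ≤ C k * starNorm ξ ^ 2 := by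
  refine ⟨lowestEigenvalue_isLittleO hd, 1 / 100, by norm_num, remainderConst,
    remainderConst_pos, ?_⟩
  choose φ R h using fun ξ : {ξ : WaveNumber d // starNorm ξ < 1 / 100} =>
    (exists_ground_state hd ξ.1 ξ.2).2
  classical
  refine ⟨fun ξ => if hξ : starNorm ξ < 1 / 100 then φ ⟨ξ, hξ⟩ else 0,
    fun ξ => if hξ : starNorm ξ < 1 / 100 then R ⟨ξ, hξ⟩ else 0, fun ξ hξ => ?_⟩
  simp only [dif_pos hξ]
  exact h ⟨ξ, hξ⟩
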